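/- Let $n\ge 2$, let $S^{n-1}$ be the unit sphere of Euclidean space $\mathbb R^n$, and let $\Xi$ be the set of its $(n-2)$-geodesics, i.e. of the sections $\xi=S^{n-1}\cap\theta^\perp$ ($\theta\in S^{n-1}$) of $S^{n-1}$ by hyperplanes through the origin. For a continuous real- or complex-valued function $f$ on $S^{n-1}$, the Minkowski–Funk transform of $f$ is the function $Mf$ on $\Xi$ given by $$(Mf)(\xi)=\int_\xi f(x)\,dx,$$ where $dx$ is the rotation-invariant surface measure on the unit sphere $\xi$ of the hyperplane, of total mass $\sigma_{n-2}=2\pi^{(n-1)/2}/\Gamma\left(\frac{n-1}{2}\right)$ (for $n=2$, the counting measure on two antipodal points). Let $f$ be an even continuous function on $S^{n-1}$ (that is, $f(-x)=f(x)$ for all $x$). Then $f$ is constant on $S^{n-1}$ if and only if $Mf$ is constant on $\Xi$. -/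

import Mathlib

open MeasureTheory Metric

/-- The unit sphere `S^{n-1}` in the Euclidean space `ℝⁿ`. -/
abbrev UnitSphere (n : ℕ) : Type := sphere (0 : EuclideanSpace ℝ (Fin n)) 1

/-- The great subsphere `S^{n-1} ∩ θ^⊥`. -/
def greatSubsphere {n : ℕ} (θ : UnitSphere n) : Set (UnitSphere n) :=
  {x | inner ℝ (x : EuclideanSpace ℝ (Fin n)) (θ : EuclideanSpace ℝ (Fin n)) = 0}

/-- The set `Ξ` of `(n-2)`-geodesics: the sections of `S^{n-1}` by hyperplanes through the
origin. -/
def Geodesic (n : ℕ) : Type := {ξ : Set (UnitSphere n) // ∃ θ : UnitSphere n, ξ = greatSubsphere θ}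

/-- The linear subspace of `ℝⁿ` spanned by a subset of the sphere. For an `(n-2)`-geodesic
(`n ≥ 2`) it is the hyperplane whose section it is. -/
abbrev spanOf {n : ℕ} (ξ : Set (UnitSphere n)) : Submodule ℝ (EuclideanSpace ℝ (Fin n)) :=
  Submodule.span ℝ ((↑) '' ξ)

/-- The inclusion of the unit sphere of a linear subspace of `ℝⁿ` into `S^{n-1}`. -/
def subspaceSphereIncl {n : ℕ} (H : Submodule ℝ (EuclideanSpace ℝ (Fin n)))
    (y : sphere (0 : H) 1) : UnitSphere n :=
  ⟨((y : H) : EuclideanSpace ℝ (Fin n)), by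
    rw [mem_sphere_zero_iff_norm]
    exact mem_sphere_zero_iff_norm.1 y.2⟩

/-- The surface measure on the unit sphere of a linear subspace `H` of `ℝⁿ`. It is the cone
measure of the Lebesgue measure of `H` (normalized so that unit cubes have volume `1`):
`s ↦ dim H * vol {t • x | 0 < t < 1, x ∈ s}`. For `dim H = n - 1` its total mass is the
area `σ_{n-2} = 2 π^{(n-1)/2} / Γ((n-1)/2)` of `S^{n-2}`. -/
noncomputable def subspaceSphereMeasure {n : ℕ}
    (H : Submodule ℝ (EuclideanSpace ℝ (Fin n))) : Measure (sphere (0 : H) 1) :=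
  (volume : Measure H).toSphere

/-- The Minkowski-Funk transform `(Mf)(ξ) = ∫_ξ f(x) dx`. -/
noncomputable def minkowskiFunk {𝕜 : Type*} [RCLike 𝕜] {n : ℕ} (f : UnitSphere n → 𝕜)
    (ξ : Geodesic n) : 𝕜 :=
  ∫ y, f (subspaceSphereIncl (spanOf ξ.1) y) ∂(subspaceSphereMeasure (spanOf ξ.1))

/-! All sections have the same positive total mass, so `M` sends constants to constants. Conversely,
subtracting a constant reduces the claim to injectivity of `M` on even continuous functions. Suppose
`Mf = 0` and fix `θ`. `M` is self-adjoint (`integral_funkAt_smul`) and sends `⟨x, θ⟩ ^ (2k)` to a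
positive multiple of `(1 - ⟨z, θ⟩²) ^ k` (`exists_funkAt_inner_pow`), so `f` integrates to zero
against every even polynomial in `⟨x, θ⟩`; against odd ones it does so by evenness. The powers `(1 +
⟨x, θ⟩) ^ k` peak at `θ`, which forces `f θ = 0`. Integrals over the sphere are taken as Haar
averages over the orthogonal group. -/

/-- The map between unit spheres induced by a linear isometry. -/
def sphereMap {V W : Type*} [NormedAddCommGroup V] [NormedSpace ℝ V] [NormedAddCommGroup W]
    [NormedSpace ℝ W] (L : V →ₗᵢ[ℝ] W) (x : sphere (0 : V) 1) : sphere (0 : W) 1 :=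
  ⟨L x, by simp⟩

/-! ### Sphere measures under isometries, and even moments of a linear form. -/

section SphereMap

variable {V W : Type*} [NormedAddCommGroup V] [InnerProductSpace ℝ V] [NormedAddCommGroup W]
    [InnerProductSpace ℝ W]

@[simp]
lemma coe_sphereMap (L : V →ₗᵢ[ℝ] W) (x : sphere (0 : V) 1) : (sphereMap L x : W) = L x := rfl

lemma continuous_sphereMap (L : V →ₗᵢ[ℝ] W) : Continuous (sphereMap L) :=
  (L.continuous.comp continuous_subtype_val).subtype_mk _

variable [FiniteDimensional ℝ V] [MeasurableSpace V] [BorelSpace V]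
  [FiniteDimensional ℝ W] [MeasurableSpace W] [BorelSpace W]

/-- An isometry preserves volume and dimension and carries cones to cones. -/
lemma map_toSphere_volume (L : V ≃ₗᵢ[ℝ] W) :
    (volume : Measure V).toSphere.map (sphereMap L.toLinearIsometry)
      = (volume : Measure W).toSphere := by
  ext s hs
  have hm := (continuous_sphereMap L.toLinearIsometry).measurable
  rw [Measure.map_apply hm hs, Measure.toSphere_apply' _ (hm hs), Measure.toSphere_apply' _ hs,
    L.toLinearEquiv.finrank_eq]
  congr 1
  rw [← L.measurePreserving.measure_preimage_equiv (f := L.toMeasurableEquiv)]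
  congr 1
  ext v
  simp only [Set.mem_smul, Set.mem_image, Set.mem_preimage]
  constructor
  · rintro ⟨t, ht, _, ⟨x, hx, rfl⟩, rfl⟩
    exact ⟨t, ht, _, ⟨_, hx, rfl⟩, by simp⟩
  · rintro ⟨t, ht, _, ⟨x, hx, rfl⟩, h⟩
    have hx' : sphereMap L.toLinearIsometry (sphereMap L.symm.toLinearIsometry x) = x := by
      ext; simp
    refine ⟨t, ht, _, ⟨sphereMap L.symm.toLinearIsometry x, by rwa [hx'], rfl⟩, ?_⟩
    apply L.injective
    simpa using h

lemma integral_sphereMap {F : Type*} [NormedAddCommGroup F] [NormedSpace ℝ F]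
    (L : V ≃ₗᵢ[ℝ] W) {f : sphere (0 : W) 1 → F} (hf : Continuous f) :
    ∫ y, f (sphereMap L.toLinearIsometry y) ∂(volume : Measure V).toSphere
      = ∫ y, f y ∂(volume : Measure W).toSphere := by
  rw [← map_toSphere_volume L, integral_map (continuous_sphereMap _).aemeasurable]
  exact hf.aestronglyMeasurable

lemma integral_inner_pow_toSphere (k : ℕ) {u : V} (hu : ‖u‖ = 1) (w : V) :
    ∫ y : sphere (0 : V) 1, (inner ℝ (y : V) w) ^ (2 * k) ∂(volume : Measure V).toSphere
      = (‖w‖ ^ 2) ^ k *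
        ∫ y : sphere (0 : V) 1, (inner ℝ (y : V) u) ^ (2 * k) ∂(volume : Measure V).toSphere := by
  have hcont : ∀ w : V, Continuous fun y : sphere (0 : V) 1 ↦ (inner ℝ (y : V) w) ^ (2 * k) :=
    fun w ↦ by fun_prop
  -- Rotation invariance reduces `w` to `‖w‖ • u`; homogeneity gives the factor.
  let R : V ≃ₗᵢ[ℝ] V := (ℝ ∙ (‖w‖ • u - w))ᗮ.reflection
  have hR : R (‖w‖ • u) = w := Submodule.reflection_sub (by simp [norm_smul, hu])
  rw [← integral_sphereMap R (hcont w), ← integral_const_mul]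
  congr 1 with y
  simp only [coe_sphereMap]
  change (inner ℝ (R (y : V)) w) ^ (2 * k) = _
  rw [← hR, R.inner_map_map, inner_smul_right, hR]
  ring

lemma integral_inner_pow_toSphere_pos (k : ℕ) {u : V} (hu : ‖u‖ = 1) :
    0 < ∫ y : sphere (0 : V) 1, (inner ℝ (y : V) u) ^ (2 * k)
      ∂(volume : Measure V).toSphere := by
  have hcont : Continuous fun y : sphere (0 : V) 1 ↦ (inner ℝ (y : V) u) ^ (2 * k) := by fun_prop
  refine hcont.integral_pos_of_hasCompactSupport_nonneg_nonzero
    (HasCompactSupport.of_compactSpace _) (fun y ↦ ?_) (x := ⟨u, by simpa using hu⟩) ?_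
  · change (0 : ℝ) ≤ (inner ℝ (y : V) u) ^ (2 * k)
    rw [pow_mul]
    exact pow_nonneg (sq_nonneg _) k
  · simp [hu]

end SphereMap

/-! ### The transform indexed by normal vectors. -/

section Funk

variable {𝕜 : Type*} [RCLike 𝕜] {n : ℕ}

/-- The integral of `f` over the unit sphere of the hyperplane `θ^⊥`. -/
noncomputable def funkAt {F : Type*} [NormedAddCommGroup F] [NormedSpace ℝ F]
    (f : UnitSphere n → F) (θ : UnitSphere n) : F :=
  ∫ y, f (sphereMap (ℝ ∙ (θ : EuclideanSpace ℝ (Fin n)))ᗮ.subtypeₗᵢ y)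
    ∂(volume : Measure (ℝ ∙ (θ : EuclideanSpace ℝ (Fin n)))ᗮ).toSphere

lemma span_greatSubsphere (θ : UnitSphere n) :
    spanOf (greatSubsphere θ) = (ℝ ∙ (θ : EuclideanSpace ℝ (Fin n)))ᗮ := by
  apply le_antisymm
  · rw [Submodule.span_le]
    rintro _ ⟨x, hx, rfl⟩
    rw [SetLike.mem_coe, Submodule.mem_orthogonal_singleton_iff_inner_left]
    exact hx
  · intro x hx
    rw [Submodule.mem_orthogonal_singleton_iff_inner_left] at hx
    by_cases h0 : x = 0
    · rw [h0]; exact Submodule.zero_mem _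
    have hn : ‖x‖ ≠ 0 := by simpa using h0
    have hmem : ‖x‖⁻¹ • x ∈ spanOf (greatSubsphere θ) := by
      refine Submodule.subset_span ⟨⟨‖x‖⁻¹ • x, ?_⟩, ?_, rfl⟩
      · rw [mem_sphere_zero_iff_norm, norm_smul, norm_inv, norm_norm, inv_mul_cancel₀ hn]
      · change inner ℝ (‖x‖⁻¹ • x) _ = 0
        rw [real_inner_smul_left, hx, mul_zero]
    have := Submodule.smul_mem _ ‖x‖ hmem
    rwa [smul_inv_smul₀ hn] at this

lemma minkowskiFunk_eq_funkAt (f : UnitSphere n → 𝕜) (ξ : Geodesic n) {θ : UnitSphere n}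
    (h : ξ.1 = greatSubsphere θ) : minkowskiFunk f ξ = funkAt f θ := by
  -- The domain of integration depends on the subspace, so the equality is substituted for variable
  -- subspaces.
  have key : ∀ H H' : Submodule ℝ (EuclideanSpace ℝ (Fin n)), H = H' →
      ∫ y, f (subspaceSphereIncl H y) ∂(subspaceSphereMeasure H)
        = ∫ y, f (sphereMap H'.subtypeₗᵢ y) ∂(volume : Measure H').toSphere := by
    rintro H _ rfl
    rfl
  exact key _ _ (by rw [h, span_greatSubsphere])

variable {F : Type*} [NormedAddCommGroup F] [NormedSpace ℝ F]

lemma funkAt_sphereMap (L : EuclideanSpace ℝ (Fin n) ≃ₗᵢ[ℝ] EuclideanSpace ℝ (Fin n))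
    {f : UnitSphere n → F} (hf : Continuous f) (θ : UnitSphere n) :
    funkAt f (sphereMap L.toLinearIsometry θ)
      = funkAt (fun x ↦ f (sphereMap L.toLinearIsometry x)) θ := by
  have key : ∀ H H' : Submodule ℝ (EuclideanSpace ℝ (Fin n)),
      H' = H.map (L.toLinearEquiv : _ →ₗ[ℝ] EuclideanSpace ℝ (Fin n)) →
      ∫ y, f (sphereMap H'.subtypeₗᵢ y) ∂(volume : Measure H').toSphere
        = ∫ y, f (sphereMap L.toLinearIsometry (sphereMap H.subtypeₗᵢ y))
          ∂(volume : Measure H).toSphere := by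
    rintro H _ rfl
    exact (integral_sphereMap (L.submoduleMap H) (hf.comp (continuous_sphereMap
      (H.map (L.toLinearEquiv : _ →ₗ[ℝ] EuclideanSpace ℝ (Fin n))).subtypeₗᵢ))).symm
  refine key _ _ ?_
  rw [coe_sphereMap]
  ext x
  simp only [Submodule.mem_orthogonal_singleton_iff_inner_left, Submodule.mem_map]
  constructor
  · intro h
    refine ⟨L.symm x, ?_, by simp⟩
    rw [← L.inner_map_map]
    simpa using h
  · rintro ⟨y, hy, rfl⟩
    rw [← L.inner_map_map] at hy
    exact hy

/-- The reflection exchanging `x` and `y` fixes everything orthogonal to both. -/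
lemma exists_isometry_sphereMap_eq (x y : UnitSphere n) :
    ∃ L : EuclideanSpace ℝ (Fin n) ≃ₗᵢ[ℝ] EuclideanSpace ℝ (Fin n),
      sphereMap L.toLinearIsometry x = y ∧
      ∀ z : UnitSphere n, inner ℝ (z : EuclideanSpace ℝ (Fin n)) x = 0 →
        inner ℝ (z : EuclideanSpace ℝ (Fin n)) y = 0 → sphereMap L.toLinearIsometry z = z := by
  refine ⟨(ℝ ∙ ((x : EuclideanSpace ℝ (Fin n)) - y))ᗮ.reflection, ?_, fun z hx hy ↦ ?_⟩
  · ext1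
    exact Submodule.reflection_sub (by simp)
  · ext1
    refine Submodule.reflection_mem_subspace_eq_self ?_
    rw [Submodule.mem_orthogonal_singleton_iff_inner_left, inner_sub_right, hx, hy, sub_zero]

lemma funkAt_const (c : F) (θ θ' : UnitSphere n) :
    funkAt (fun _ ↦ c) θ = funkAt (fun _ ↦ c) θ' := by
  obtain ⟨L, rfl, -⟩ := exists_isometry_sphereMap_eq θ' θ
  exact funkAt_sphereMap L continuous_const θ'

lemma exists_orthogonal (hn : 2 ≤ n) (θ : UnitSphere n) :
    ∃ u : UnitSphere n, inner ℝ (u : EuclideanSpace ℝ (Fin n)) θ = 0 := by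
  have h1 := (ℝ ∙ (θ : EuclideanSpace ℝ (Fin n))).finrank_add_finrank_orthogonal
  rw [finrank_euclideanSpace_fin] at h1
  have h2 := finrank_span_le_card (R := ℝ) ({(θ : EuclideanSpace ℝ (Fin n))} : Set _)
  simp only [Set.toFinset_singleton, Finset.card_singleton] at h2
  have : Nontrivial (ℝ ∙ (θ : EuclideanSpace ℝ (Fin n)))ᗮ :=
    Module.nontrivial_of_finrank_pos (R := ℝ) (by omega)
  obtain ⟨u, hu⟩ := exists_norm_eq (ℝ ∙ (θ : EuclideanSpace ℝ (Fin n)))ᗮ zero_le_one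
  exact ⟨⟨u, by simpa using hu⟩, Submodule.mem_orthogonal_singleton_iff_inner_left.1 u.2⟩

/-- On `z^⊥` pairing with `θ` is pairing with its projection, of squared norm `1 - ⟨z, θ⟩²`. The
case `k = 0` gives the mass of a section. -/
lemma exists_funkAt_inner_pow (hn : 2 ≤ n) (k : ℕ) :
    ∃ c : ℝ, 0 < c ∧ ∀ θ z : UnitSphere n,
      funkAt (fun x ↦ (inner ℝ (x : EuclideanSpace ℝ (Fin n)) (θ : EuclideanSpace ℝ (Fin n)))
        ^ (2 * k)) z
      = (1 - (inner ℝ (z : EuclideanSpace ℝ (Fin n)) (θ : EuclideanSpace ℝ (Fin n))) ^ 2) ^ k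
        * c := by
  by_cases hne : Nonempty (UnitSphere n)
  swap
  · exact ⟨1, one_pos, fun θ ↦ (hne ⟨θ⟩).elim⟩
  obtain ⟨z₀⟩ := hne
  obtain ⟨u, hu⟩ := exists_orthogonal hn z₀
  let H := (ℝ ∙ (z₀ : EuclideanSpace ℝ (Fin n)))ᗮ
  let u' : H := ⟨u, Submodule.mem_orthogonal_singleton_iff_inner_left.2 hu⟩
  have hu' : ‖u'‖ = 1 := by simp [u']
  refine ⟨_, integral_inner_pow_toSphere_pos k hu', fun θ z ↦ ?_⟩
  obtain ⟨L, rfl, -⟩ := exists_isometry_sphereMap_eq z₀ z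
  rw [funkAt_sphereMap L (by fun_prop)]
  have hL : ∀ x : EuclideanSpace ℝ (Fin n),
      inner ℝ (L x) (θ : EuclideanSpace ℝ (Fin n)) = inner ℝ x (L.symm θ) := fun x ↦ by
    rw [← L.inner_map_map x, L.apply_symm_apply]
  have hnorm : ‖H.orthogonalProjectionOnto (L.symm θ)‖ ^ 2
      = 1 - (inner ℝ (z₀ : EuclideanSpace ℝ (Fin n)) (L.symm θ)) ^ 2 := by
    have h1 := Submodule.norm_sq_eq_add_norm_sq_projection (L.symm (θ : EuclideanSpace ℝ (Fin n)))
      (ℝ ∙ (z₀ : EuclideanSpace ℝ (Fin n)))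
    have h2 : ‖(ℝ ∙ (z₀ : EuclideanSpace ℝ (Fin n))).orthogonalProjectionOnto (L.symm θ)‖ ^ 2
        = (inner ℝ (z₀ : EuclideanSpace ℝ (Fin n)) (L.symm θ)) ^ 2 := by
      rw [← Submodule.norm_coe, ← Submodule.starProjection_apply,
        Submodule.starProjection_unit_singleton ℝ (by simp), norm_smul]
      simp
    have h3 : ‖L.symm (θ : EuclideanSpace ℝ (Fin n))‖ = 1 := by simp
    rw [h2, h3] at h1
    linarith
  simp only [coe_sphereMap, LinearIsometryEquiv.coe_toLinearIsometry, hL]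
  rw [← hnorm, ← integral_inner_pow_toSphere k hu']
  unfold funkAt
  congr 1 with y
  simp only [coe_sphereMap, Submodule.coe_subtypeₗᵢ, Submodule.coe_subtype]
  rw [Submodule.inner_orthogonalProjectionOnto_eq_of_mem_left]

end Funk

/-! ### Averaging over the orthogonal group, duality and injectivity. -/

section Rotation

variable {n : ℕ}

/-- The orthogonal group of `ℝⁿ`, as a topological group. -/
def OrthGroup (n : ℕ) : Type :=
  unitary (EuclideanSpace ℝ (Fin n) →L[ℝ] EuclideanSpace ℝ (Fin n))

namespace OrthGroup

noncomputable instance : Group (OrthGroup n) :=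
  inferInstanceAs (Group (unitary (EuclideanSpace ℝ (Fin n) →L[ℝ] EuclideanSpace ℝ (Fin n))))

instance : TopologicalSpace (OrthGroup n) :=
  inferInstanceAs (TopologicalSpace
    (unitary (EuclideanSpace ℝ (Fin n) →L[ℝ] EuclideanSpace ℝ (Fin n))))

instance : ContinuousStar (EuclideanSpace ℝ (Fin n) →L[ℝ] EuclideanSpace ℝ (Fin n)) :=
  ⟨(ContinuousLinearMap.adjoint (𝕜 := ℝ) (E := EuclideanSpace ℝ (Fin n))
    (F := EuclideanSpace ℝ (Fin n))).continuous⟩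

lemma continuous_coe : Continuous fun g : OrthGroup n ↦
    (g.1 : EuclideanSpace ℝ (Fin n) →L[ℝ] EuclideanSpace ℝ (Fin n)) :=
  continuous_subtype_val

instance : IsTopologicalGroup (OrthGroup n) where
  continuous_mul := ((continuous_coe.comp continuous_fst).mul
    (continuous_coe.comp continuous_snd)).subtype_mk _
  continuous_inv := continuous_coe.star.subtype_mk _

instance : MeasurableSpace (OrthGroup n) := borel _

instance : BorelSpace (OrthGroup n) := ⟨rfl⟩

instance : CompactSpace (OrthGroup n) := by
  refine isCompact_iff_compactSpace.1 (?_ : IsCompact (unitary (EuclideanSpace ℝ (Fin n) →L[ℝ]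
    EuclideanSpace ℝ (Fin n)) : Set (EuclideanSpace ℝ (Fin n) →L[ℝ] EuclideanSpace ℝ (Fin n))))
  refine Metric.isCompact_of_isClosed_isBounded isClosed_unitary ?_
  refine (Metric.isBounded_closedBall (x := 0) (r := 1)).subset fun g hg ↦ ?_
  rw [mem_closedBall_zero_iff]
  refine ContinuousLinearMap.opNorm_le_bound _ zero_le_one fun x ↦ ?_
  rw [one_mul]
  exact (Unitary.norm_map ⟨g, hg⟩ x).le

/-- Orthogonal transformations as linear isometries. -/
noncomputable def toIsometry :
    OrthGroup n ≃* (EuclideanSpace ℝ (Fin n) ≃ₗᵢ[ℝ] EuclideanSpace ℝ (Fin n)) :=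
  Unitary.linearIsometryEquiv

lemma continuous_toIsometry_apply :
    Continuous fun p : OrthGroup n × EuclideanSpace ℝ (Fin n) ↦ toIsometry p.1 p.2 :=
  (continuous_coe.comp continuous_fst).clm_apply continuous_snd

end OrthGroup

open OrthGroup

/-- The action of the inverse of an orthogonal transformation on the sphere. -/
noncomputable def invRot (g : OrthGroup n) (x : UnitSphere n) : UnitSphere n :=
  sphereMap (toIsometry g⁻¹).toLinearIsometry x

lemma continuous_invRot :
    Continuous fun p : OrthGroup n × UnitSphere n ↦ invRot p.1 p.2 :=
  (continuous_toIsometry_apply.comp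
    (continuous_fst.inv.prodMk (continuous_subtype_val.comp continuous_snd))).subtype_mk _

lemma continuous_invRot_left (x : UnitSphere n) : Continuous fun g : OrthGroup n ↦ invRot g x := by
  have h := continuous_invRot.comp (Continuous.prodMk_left (X := OrthGroup n) x)
  exact h

/-- Since `invRot` uses inverses, left invariance of Haar measure lets `L` move the base points. -/
lemma invRot_mul (L : EuclideanSpace ℝ (Fin n) ≃ₗᵢ[ℝ] EuclideanSpace ℝ (Fin n))
    (g : OrthGroup n) (x : UnitSphere n) :
    invRot ((toIsometry.symm L)⁻¹ * g) x
      = invRot g (sphereMap L.toLinearIsometry x) := by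
  ext1
  simp [invRot]

lemma exists_invRot_eq (x y : UnitSphere n) : ∃ g : OrthGroup n, invRot g x = y := by
  obtain ⟨L, hL, -⟩ := exists_isometry_sphereMap_eq x y
  refine ⟨(toIsometry.symm L)⁻¹ * 1, ?_⟩
  rw [invRot_mul, hL]
  ext1
  simp [invRot]

variable {F : Type*} [NormedAddCommGroup F] [NormedSpace ℝ F]

lemma funkAt_invRot (g : OrthGroup n) {f : UnitSphere n → F} (hf : Continuous f)
    (θ : UnitSphere n) : funkAt f (invRot g θ) = funkAt (fun x ↦ f (invRot g x)) θ :=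
  funkAt_sphereMap _ hf θ

lemma integral_invRot_sphereMap
    (L : EuclideanSpace ℝ (Fin n) ≃ₗᵢ[ℝ] EuclideanSpace ℝ (Fin n))
    (Φ : UnitSphere n → UnitSphere n → F) (x y : UnitSphere n) :
    ∫ g : OrthGroup n, Φ (invRot g (sphereMap L.toLinearIsometry x))
        (invRot g (sphereMap L.toLinearIsometry y)) ∂Measure.haar
      = ∫ g : OrthGroup n, Φ (invRot g x) (invRot g y) ∂Measure.haar := by
  simp only [← invRot_mul]
  exact integral_mul_left_eq_self
    (fun g : OrthGroup n ↦ Φ (invRot g x) (invRot g y)) (toIsometry.symm L)⁻¹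

lemma integral_invRot_eq (Φ : UnitSphere n → UnitSphere n → F) {x y z : UnitSphere n}
    (hy : inner ℝ (x : EuclideanSpace ℝ (Fin n)) y = 0)
    (hz : inner ℝ (x : EuclideanSpace ℝ (Fin n)) z = 0) :
    ∫ g : OrthGroup n, Φ (invRot g x) (invRot g z) ∂Measure.haar
      = ∫ g : OrthGroup n, Φ (invRot g x) (invRot g y) ∂Measure.haar := by
  obtain ⟨L, hL, hfix⟩ := exists_isometry_sphereMap_eq y z
  have h := integral_invRot_sphereMap L Φ x y
  rwa [hL, hfix x hy hz] at h

/-- Averaging a function of an orthonormal pair over the second vector. -/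
lemma integral_invRot_funkAt [CompleteSpace F] {Φ : UnitSphere n → UnitSphere n → F}
    (hΦ : Continuous fun p : UnitSphere n × UnitSphere n ↦ Φ p.1 p.2) {x y : UnitSphere n}
    (hy : inner ℝ (x : EuclideanSpace ℝ (Fin n)) y = 0) :
    ∫ g : OrthGroup n, funkAt (Φ (invRot g x)) (invRot g x) ∂Measure.haar
      = funkAt (fun _ ↦ (1 : ℝ)) x •
        ∫ g : OrthGroup n, Φ (invRot g x) (invRot g y) ∂Measure.haar := by
  have h1 : ∀ g : OrthGroup n, funkAt (Φ (invRot g x)) (invRot g x)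
      = funkAt (fun z ↦ Φ (invRot g x) (invRot g z)) x := fun g ↦
    funkAt_invRot g (hΦ.comp (Continuous.prodMk_right _)) x
  simp only [h1]
  unfold funkAt
  rw [integral_integral_swap_of_hasCompactSupport _ (HasCompactSupport.of_compactSpace _)]
  · rw [integral_const, smul_eq_mul, mul_one, ← integral_const]
    -- After Fubini the Haar average is the same for every `z` orthogonal to `x`.
    congr 1 with z
    refine integral_invRot_eq Φ hy ?_
    have := z.1.2
    rw [Submodule.mem_orthogonal_singleton_iff_inner_right] at this
    exact this
  · have h2 := continuous_invRot.comp (continuous_fst.prodMk ((continuous_sphereMap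
      (ℝ ∙ (x : EuclideanSpace ℝ (Fin n)))ᗮ.subtypeₗᵢ).comp continuous_snd))
    have h3 := hΦ.comp (((continuous_invRot_left x).comp continuous_fst).prodMk h2)
    exact h3

/-- Duality for the Minkowski-Funk transform. -/
lemma integral_funkAt_smul [CompleteSpace F] {h : UnitSphere n → ℝ} {f : UnitSphere n → F}
    (hh : Continuous h) (hf : Continuous f) {x y : UnitSphere n}
    (hxy : inner ℝ (x : EuclideanSpace ℝ (Fin n)) y = 0) :
    ∫ g : OrthGroup n, funkAt h (invRot g y) • f (invRot g y) ∂Measure.haar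
      = ∫ g : OrthGroup n, h (invRot g x) • funkAt f (invRot g x) ∂Measure.haar := by
  -- Both sides are the same multiple of the average of `h a • f b` over orthonormal pairs, with
  -- either vector integrated out first.
  have h1 := integral_invRot_funkAt (Φ := fun a b ↦ h a • f b) (by fun_prop) hxy
  have h2 := integral_invRot_funkAt (Φ := fun a b ↦ h b • f a) (by fun_prop)
    (x := y) (y := x) (by rwa [real_inner_comm])
  rw [funkAt_const _ y x, ← h1] at h2
  have h3 : ∀ z, funkAt (fun b ↦ h b • f z) z = funkAt h z • f z := fun z ↦
    integral_smul_const _ _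
  have h4 : ∀ z, funkAt (fun b ↦ h z • f b) z = h z • funkAt f z := fun z ↦
    integral_smul _ _
  simpa only [h3, h4] using h2

/-- The weight is nonnegative with unique maximum at `θ`, and the orbit measure charges every
nonempty open set, so the normalized integrals tend to `f θ`. -/
lemma eq_zero_of_integral_pow_smul_eq_zero [CompleteSpace F] {f : UnitSphere n → F}
    (hf : Continuous f) {y θ : UnitSphere n}
    (h : ∀ k : ℕ, ∫ g : OrthGroup n,
      (1 + inner ℝ (invRot g y : EuclideanSpace ℝ (Fin n)) θ) ^ k • f (invRot g y)
        ∂Measure.haar = 0) : f θ = 0 := by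
  let ν : Measure (UnitSphere n) := Measure.map (fun g : OrthGroup n ↦ invRot g y) Measure.haar
  have hm := continuous_invRot_left y
  have hfin : IsFiniteMeasure ν := Measure.isFiniteMeasure_map _ _
  have hpos : ν.IsOpenPosMeasure :=
    hm.isOpenPosMeasure_map fun x ↦ exists_invRot_eq y x
  let c : UnitSphere n → ℝ := fun x ↦ 1 + inner ℝ (x : EuclideanSpace ℝ (Fin n)) θ
  have hc : Continuous c := by fun_prop
  have hle : ∀ x : UnitSphere n, |inner ℝ (x : EuclideanSpace ℝ (Fin n)) θ| ≤ 1 := fun x ↦ by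
    simpa using abs_real_inner_le_norm (x : EuclideanSpace ℝ (Fin n)) θ
  have hcθ : c θ = 2 := by
    simp only [c, real_inner_self_eq_norm_sq, norm_eq_of_mem_sphere]
    norm_num
  have key := tendsto_setIntegral_pow_smul_of_unique_maximum_of_isCompact_of_continuousOn
    (μ := ν) (x₀ := θ) (isCompact_univ) hc.continuousOn (fun x _ hx ↦ ?_)
    (fun x _ ↦ by have := abs_le.1 (hle x); simp only [c]; linarith) (by rw [hcθ]; norm_num)
    (by simp) hf.continuousOn
  · refine (tendsto_nhds_unique key ?_)
    have hz : ∀ k : ℕ, ∫ x in Set.univ, c x ^ k • f x ∂ν = 0 := fun k ↦ by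
      rw [Measure.restrict_univ, integral_map hm.aemeasurable]
      · exact h k
      · exact ((hc.pow k).smul hf).aestronglyMeasurable
    simp only [hz, smul_zero]
    exact tendsto_const_nhds
  · rw [hcθ]
    have h1 : inner ℝ (x : EuclideanSpace ℝ (Fin n)) (θ : EuclideanSpace ℝ (Fin n)) ≠ 1 := by
      intro h1
      exact hx (Subtype.ext ((inner_eq_one_iff_of_norm_eq_one (by simp) (by simp)).1 h1))
    have h2 := lt_of_le_of_ne (abs_le.1 (hle x)).2 h1
    simp only [c]
    linarith

open Polynomial in
/-- An even continuous function with vanishing Minkowski-Funk transform is zero. -/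
lemma eq_zero_of_funkAt_eq_zero [CompleteSpace F] (hn : 2 ≤ n) {f : UnitSphere n → F}
    (hf : Continuous f) (heven : ∀ x, f (-x) = f x) (h0 : ∀ x, funkAt f x = 0) (θ : UnitSphere n) :
    f θ = 0 := by
  obtain ⟨y, hxy⟩ := exists_orthogonal hn θ
  rw [real_inner_comm] at hxy
  let t : OrthGroup n → ℝ := fun g ↦ inner ℝ (invRot g y : EuclideanSpace ℝ (Fin n)) θ
  have hfy : Continuous fun g : OrthGroup n ↦ f (invRot g y) := hf.comp (continuous_invRot_left y)
  have ht : Continuous t :=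
    (continuous_subtype_val.comp (continuous_invRot_left y)).inner continuous_const
  have hint : ∀ p : ℝ[X], Integrable (fun g : OrthGroup n ↦ p.eval (t g) • f (invRot g y))
      Measure.haar := fun p ↦
    ((p.continuous.comp ht).smul hfy).integrable_of_hasCompactSupport
      (HasCompactSupport.of_compactSpace _)
  -- By linearity it suffices to kill `Λ` on monomials.
  let Λ : ℝ[X] →ₗ[ℝ] F :=
    { toFun := fun p ↦ ∫ g : OrthGroup n, p.eval (t g) • f (invRot g y) ∂Measure.haar
      map_add' := fun p q ↦ by
        simp only [eval_add, add_smul]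
        exact integral_add (hint p) (hint q)
      map_smul' := fun a p ↦ by
        simp only [eval_smul, smul_assoc, RingHom.id_apply]
        exact integral_smul _ _ }
  have hodd : ∀ k : ℕ, Λ (X ^ (2 * k + 1)) = 0 := fun k ↦ by
    have hneg : ∀ z : UnitSphere n,
        sphereMap (LinearIsometryEquiv.neg ℝ).toLinearIsometry z = -z := fun z ↦ by ext1; simp
    have hneg' : ∀ g : OrthGroup n, invRot g (-y) = -invRot g y := fun g ↦ by
      ext1; simp [invRot]
    have h := integral_invRot_sphereMap (LinearIsometryEquiv.neg ℝ)
      (fun a _ ↦ (inner ℝ (a : EuclideanSpace ℝ (Fin n)) θ) ^ (2 * k + 1) • f a) y y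
    simp only [hneg, hneg', heven] at h
    have h2 : ∀ z : UnitSphere n, (inner ℝ ((-z : UnitSphere n) : EuclideanSpace ℝ (Fin n))
        (θ : EuclideanSpace ℝ (Fin n))) ^ (2 * k + 1) • f z
        = - ((inner ℝ (z : EuclideanSpace ℝ (Fin n)) (θ : EuclideanSpace ℝ (Fin n)))
          ^ (2 * k + 1) • f z) := fun z ↦ by
      rw [show ((-z : UnitSphere n) : EuclideanSpace ℝ (Fin n)) = -z from rfl, inner_neg_left,
        Odd.neg_pow (by simp), neg_smul]
    simp only [h2, integral_neg] at h
    have h3 : (2 : ℝ) • Λ (X ^ (2 * k + 1)) = 0 := by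
      rw [two_smul, add_eq_zero_iff_neg_eq]
      simpa [Λ, t] using h
    exact (smul_eq_zero.1 h3).resolve_left two_ne_zero
  have hsin : ∀ k : ℕ, Λ ((1 - X ^ 2) ^ k) = 0 := fun k ↦ by
    obtain ⟨c, hc, hfc⟩ := exists_funkAt_inner_pow hn k
    have h := integral_funkAt_smul (h := fun x ↦ (inner ℝ (x : EuclideanSpace ℝ (Fin n))
      (θ : EuclideanSpace ℝ (Fin n))) ^ (2 * k)) (by fun_prop) hf hxy
    simp only [hfc, h0, smul_zero, integral_zero, mul_comm _ c, mul_smul, integral_smul] at h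
    simpa [Λ, t] using (smul_eq_zero.1 h).resolve_left hc.ne'
  have heven' : ∀ k : ℕ, Λ (X ^ (2 * k)) = 0 := fun k ↦ by
    -- Powers of `1 - X²` span the even polynomials.
    have : (X : ℝ[X]) ^ (2 * k) = ((-1 : ℝ[X]) * (1 - X ^ 2) + 1) ^ k := by
      rw [pow_mul]; ring
    rw [this, add_pow, map_sum]
    refine Finset.sum_eq_zero fun j _ ↦ ?_
    have : ((-1 : ℝ[X]) * (1 - X ^ 2)) ^ j * 1 ^ (k - j) * (k.choose j : ℝ[X])
        = ((-1 : ℝ) ^ j * (k.choose j : ℝ)) • (1 - X ^ 2) ^ j := by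
      rw [smul_eq_C_mul, mul_pow, one_pow, map_mul, map_pow, map_neg, map_one, C_eq_natCast]
      ring
    rw [this, map_smul, hsin, smul_zero]
  refine eq_zero_of_integral_pow_smul_eq_zero hf (y := y) fun k ↦ ?_
  suffices Λ ((X + 1) ^ k) = 0 by simpa [Λ, t, add_comm] using this
  rw [add_pow, map_sum]
  refine Finset.sum_eq_zero fun j _ ↦ ?_
  have : (X : ℝ[X]) ^ j * 1 ^ (k - j) * (k.choose j : ℝ[X]) = (k.choose j : ℝ) • X ^ j := by
    rw [smul_eq_C_mul, one_pow, C_eq_natCast]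
    ring
  rw [this, map_smul]
  obtain ⟨m, rfl | rfl⟩ := j.even_or_odd'
  · rw [heven', smul_zero]
  · rw [hodd, smul_zero]

end Rotation

theorem mainTheorem5 {𝕜 : Type*} [RCLike 𝕜] (n : ℕ) (hn : 2 ≤ n)
    (f : UnitSphere n → 𝕜) (hf : Continuous f) (heven : ∀ x : UnitSphere n, f (-x) = f x) :
    (∃ c : 𝕜, ∀ x : UnitSphere n, f x = c) ↔
      (∃ c : 𝕜, ∀ ξ : Geodesic n, minkowskiFunk f ξ = c) := by
  have : Nontrivial (EuclideanSpace ℝ (Fin n)) :=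
    Module.nontrivial_of_finrank_pos (R := ℝ) (by rw [finrank_euclideanSpace_fin]; omega)
  obtain ⟨z, hz⟩ := exists_norm_eq (EuclideanSpace ℝ (Fin n)) zero_le_one
  let θ₀ : UnitSphere n := ⟨z, by simpa using hz⟩
  constructor
  · rintro ⟨c, hc⟩
    obtain rfl : f = fun _ ↦ c := funext hc
    refine ⟨funkAt (fun _ ↦ c) θ₀, fun ξ ↦ ?_⟩
    obtain ⟨θ, hθ⟩ := ξ.2
    rw [minkowskiFunk_eq_funkAt _ ξ hθ, funkAt_const]
  · rintro ⟨c, hc⟩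
    have hfc : ∀ θ, funkAt f θ = c := fun θ ↦
      (minkowskiFunk_eq_funkAt f (⟨greatSubsphere θ, θ, rfl⟩ : Geodesic n) rfl).symm.trans (hc _)
    obtain ⟨a, ha, haθ⟩ := exists_funkAt_inner_pow hn 0
    have hconst : ∀ (b : 𝕜) (θ : UnitSphere n), funkAt (fun _ ↦ b) θ = a • b := fun b θ ↦ by
      have h1 : funkAt (fun _ : UnitSphere n ↦ (1 : ℝ)) θ = a := by simpa using haθ θ₀ θ
      rw [← h1]
      simp [funkAt]
    -- With `a` the mass of a section, the constant `a⁻¹ • c` has transform `c`.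
    refine ⟨a⁻¹ • c, fun x ↦ sub_eq_zero.1 ?_⟩
    refine eq_zero_of_funkAt_eq_zero hn (f := fun x ↦ f x - a⁻¹ • c)
      (hf.sub continuous_const) (fun x ↦ by rw [heven]) (fun θ ↦ ?_) x
    have h2 : funkAt (fun x ↦ f x - a⁻¹ • c) θ
        = funkAt f θ - funkAt (fun _ ↦ a⁻¹ • c) θ := by
      refine integral_sub (Continuous.integrable_of_hasCompactSupport
        (hf.comp (continuous_sphereMap _)) (HasCompactSupport.of_compactSpace _)) ?_
      exact integrable_const _
    rw [h2, hfc, hconst, smul_inv_smul₀ ha.ne', sub_self]
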